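/- For real numbers $\alpha,\beta$ let $$A_1=\begin{pmatrix}\cos\alpha&0\\0&\cos\beta\end{pmatrix},\qquad A_2=\begin{pmatrix}0&\sin\beta\\ \sin\alpha&0\end{pmatrix},$$ and let $\Phi(\rho)=A_1\rho A_1^*+A_2\rho A_2^*$ be the qubit channel on $2\times 2$ complex matrices with Kraus operators $A_1,A_2$. Assume that its Choi matrix $\sum_{i,j}E_{ij}\otimes\Phi(E_{ij})$ has rank $2$. Then $\Phi$ is antidegradable if and only if $\cos(2\alpha)\cos(2\beta)\le 0$. Here a channel is a completely positive trace-preserving linear map between full matrix algebras. Two channels $\Psi$ (with output space $\mathcal Y$) and $\widetilde\Psi$ (with output space $\mathcal Z$) on the same input space $\mathcal X$ are complementary if there is an isometry $V:\mathcal X\to\mathcal Y\otimes\mathcal Z$ such that $\Psi(\rho)=\operatorname{tr}_{\mathcal Z}(V\rho V^*)$ and $\widetilde\Psi(\rho)=\operatorname{tr}_{\mathcal Y}(V\rho V^*)$ for all $\rho$. A channel $\Psi$ is antidegradable if there are a complementary channel $\widetilde\Psi$ of $\Psi$ (with $\mathcal Z$ finite-dimensional) and a channel $\Xi$ such that $\Psi=\Xi\circ\widetilde\Psi$.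 -/

import Mathlib

open scoped Matrix ComplexOrder

namespace QChannel

variable {m n k ι : Type*}

/-- The map `id ⊗ Φ`: apply `Φ` to every block of a block matrix. -/
def ampliation (r : ℕ) (Φ : Matrix n n ℂ →ₗ[ℂ] Matrix m m ℂ)
    (M : Matrix (Fin r × n) (Fin r × n) ℂ) : Matrix (Fin r × m) (Fin r × m) ℂ :=
  Matrix.of fun p q => Φ (Matrix.of fun a b => M (p.1, a) (q.1, b)) p.2 q.2

/-- Complete positivity: `id_r ⊗ Φ` preserves positive semidefiniteness for every `r`. -/
def IsCompletelyPositive (Φ : Matrix n n ℂ →ₗ[ℂ] Matrix m m ℂ) : Prop :=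
  ∀ (r : ℕ) (M : Matrix (Fin r × n) (Fin r × n) ℂ),
    M.PosSemidef → (ampliation r Φ M).PosSemidef

/-- Quantum channels: completely positive trace preserving linear maps. -/
structure IsChannel [Fintype m] [Fintype n] (Φ : Matrix n n ℂ →ₗ[ℂ] Matrix m m ℂ) : Prop where
  completelyPositive : IsCompletelyPositive Φ
  tracePreserving : ∀ ρ : Matrix n n ℂ, (Φ ρ).trace = ρ.trace

/-- The partial trace over the second tensor factor. -/
def traceSnd [Fintype k] (M : Matrix (m × k) (m × k) ℂ) : Matrix m m ℂ :=
  Matrix.of fun a b => ∑ e, M (a, e) (b, e)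

/-- The partial trace over the first tensor factor. -/
def traceFst [Fintype m] (M : Matrix (m × k) (m × k) ℂ) : Matrix k k ℂ :=
  Matrix.of fun e f => ∑ a, M (a, e) (a, f)

/-- Two channels are complementary if a common Stinespring isometry `V` from the input space
to (output space) ⊗ (environment) yields them by tracing out the environment and the output
space, respectively. -/
def IsComplementary [Fintype m] [Fintype n] [DecidableEq n] [Fintype k]
    (Ψ : Matrix n n ℂ →ₗ[ℂ] Matrix m m ℂ) (Ψc : Matrix n n ℂ →ₗ[ℂ] Matrix k k ℂ) : Prop :=
  IsChannel Ψ ∧ IsChannel Ψc ∧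
    ∃ V : Matrix (m × k) n ℂ, Vᴴ * V = 1 ∧
      (∀ ρ, Ψ ρ = traceSnd (V * ρ * Vᴴ)) ∧ (∀ ρ, Ψc ρ = traceFst (V * ρ * Vᴴ))

/-- A channel `Ψ` is antidegradable if `Ψ = Ξ ∘ Ψc` for a complementary channel `Ψc`
(into the operators on some finite-dimensional environment) and some channel `Ξ`. -/
def IsAntidegradable [Fintype m] [Fintype n] [DecidableEq n]
    (Ψ : Matrix n n ℂ →ₗ[ℂ] Matrix m m ℂ) : Prop :=
  ∃ (d : ℕ) (Ψc : Matrix n n ℂ →ₗ[ℂ] Matrix (Fin d) (Fin d) ℂ)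
    (Ξ : Matrix (Fin d) (Fin d) ℂ →ₗ[ℂ] Matrix m m ℂ),
    IsComplementary Ψ Ψc ∧ IsChannel Ξ ∧ Ψ = Ξ ∘ₗ Ψc

/-- The Choi matrix `∑ i j, E i j ⊗ Φ (E i j)`. -/
def choiMatrix [DecidableEq n] (Φ : Matrix n n ℂ →ₗ[ℂ] Matrix m m ℂ) :
    Matrix (n × m) (n × m) ℂ :=
  Matrix.of fun p q => Φ (Matrix.single p.1 q.1 1) p.2 q.2

/-- The map `ρ ↦ ∑ i, K i * ρ * (K i)ᴴ` with Kraus operators `K i`. -/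
def krausMap [Fintype ι] [Fintype n] (K : ι → Matrix m n ℂ) :
    Matrix n n ℂ →ₗ[ℂ] Matrix m m ℂ where
  toFun ρ := ∑ i, K i * ρ * (K i)ᴴ
  map_add' ρ σ := by simp only [Matrix.mul_add, Matrix.add_mul, Finset.sum_add_distrib]
  map_smul' c ρ := by
    simp only [Matrix.mul_smul, Matrix.smul_mul, Finset.smul_sum, RingHom.id_apply]

/-- The Kraus operator `diag (cos α, cos β)`. -/
noncomputable def kraus₁ (α β : ℝ) : Matrix (Fin 2) (Fin 2) ℂ :=
  !![(Real.cos α : ℂ), 0; 0, (Real.cos β : ℂ)]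

/-- The off-diagonal Kraus operator with entries `sin β` (top right) and `sin α` (bottom left). -/
noncomputable def kraus₂ (α β : ℝ) : Matrix (Fin 2) (Fin 2) ℂ :=
  !![0, (Real.sin β : ℂ); (Real.sin α : ℂ), 0]

end QChannel

/-!
Writing a Stinespring isometry in coordinates of the environment gives Kraus operators, and
exchanging output and environment turns `K e a j` into the Kraus family `K' a e j` of the
complementary channel. Two Kraus families `K`, `L` of the same map, read as families of vectors
`K · a j` and `L · a j`, have the same Gram matrix (the Choi matrix up to transposition), so a
contraction `U` carries `K` to `L`. Precomposing with `σ ↦ U σ Uᴴ` thus moves a degrading map from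
any complementary channel to the one of a fixed Kraus family, where it is still completely positive
and does not increase traces.

Here the complementary channel sends the basis projections `E₀₀` and `E₁₁` to
`diag (cos² α, sin² α)` and `diag (cos² β, sin² β)`, whereas the first diagonal entries of their
images under `Φ` are `cos² α` and `sin² β`. If `p` and `q` are the first diagonal entries of the
images of `E₀₀` and `E₁₁` under a degrading map, then `r = p - q ∈ [-1, 1]` satisfies
`(cos 2α - cos 2β) r = cos 2α + cos 2β`. Conversely, any such `r` yields a degrading channel with
Kraus operators of the same shape, and such an `r` exists iff `cos 2α * cos 2β ≤ 0`.
-/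

namespace QChannel

open Matrix

theorem mul_nonpos_iff_exists_abs_le_one {𝕂 : Type*} [Field 𝕂] [LinearOrder 𝕂]
    [IsStrictOrderedRing 𝕂] {u w : 𝕂} :
    u * w ≤ 0 ↔ ∃ r, |r| ≤ 1 ∧ (u - w) * r = u + w := by
  have mul_nonpos_iff_abs_le : u * w ≤ 0 ↔ |u + w| ≤ |u - w| := by
    rw [← sq_le_sq]
    constructor <;> intro h <;> linarith
  rw [mul_nonpos_iff_abs_le]
  constructor
  · intro abs_le
    refine ⟨(u + w) / (u - w), ?_, ?_⟩
    · rw [abs_div]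
      exact div_le_one_of_le₀ abs_le (abs_nonneg _)
    · rw [mul_comm]
      exact div_mul_cancel_of_imp fun huw => by simpa [huw] using abs_le
  · rintro ⟨r, hr, h⟩
    rw [← h, abs_mul]
    exact mul_le_of_le_one_right (abs_nonneg _) hr

section Contraction

variable {𝕜 E F G m n : Type*} [RCLike 𝕜]
  [NormedAddCommGroup F] [InnerProductSpace 𝕜 F] [NormedAddCommGroup G] [InnerProductSpace 𝕜 G]

theorem exists_norm_le_one_comp_eq_of_norm_le [AddCommGroup E] [Module 𝕜 E] {f : E →ₗ[𝕜] F}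
    {g : E →ₗ[𝕜] G} [f.range.HasOrthogonalProjection] (h : ∀ x, ‖g x‖ ≤ ‖f x‖) :
    ∃ T : F →L[𝕜] G, ‖T‖ ≤ 1 ∧ ∀ x, T (f x) = g x := by
  obtain ⟨s, hs⟩ := f.rangeRestrict.exists_rightInverse_of_surjective f.range_rangeRestrict
  have f_s (z : f.range) : f (s z) = z := congrArg Subtype.val (LinearMap.congr_fun hs z)
  let T₀ : f.range →L[𝕜] G := (g ∘ₗ s).mkContinuous 1 fun z => by
    simpa only [one_mul, LinearMap.comp_apply, f_s, Submodule.coe_norm] using h (s z)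
  have T₀_norm : ‖T₀‖ ≤ 1 := LinearMap.mkContinuous_norm_le _ zero_le_one _
  refine ⟨T₀ ∘L f.range.orthogonalProjectionOnto, ?_, fun x => ?_⟩
  · exact (T₀.opNorm_comp_le _).trans
      (mul_le_one₀ T₀_norm (norm_nonneg _) f.range.orthogonalProjectionOnto_norm_le)
  · have hx : f (s (f.rangeRestrict x) - x) = 0 := by
      rw [map_sub, f_s, LinearMap.codRestrict_apply, sub_self]
    have gx : g (s (f.rangeRestrict x) - x) = 0 := by
      simpa [hx] using h (s (f.rangeRestrict x) - x)
    rw [map_sub, sub_eq_zero] at gx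
    calc T₀ (f.range.orthogonalProjectionOnto (f x)) = T₀ (f.rangeRestrict x) :=
          congrArg T₀ (f.range.orthogonalProjectionOnto_mem_subspace_eq_self (f.rangeRestrict x))
      _ = g x := gx

theorem exists_norm_le_one_apply_eq_of_posSemidef_gram_sub_gram [Finite n] {v : n → F} {w : n → G}
    (h : (gram 𝕜 v - gram 𝕜 w).PosSemidef) :
    ∃ T : F →L[𝕜] G, ‖T‖ ≤ 1 ∧ ∀ p, T (v p) = w p := by
  classical
  cases nonempty_fintype n
  have norm_le (c : n → 𝕜) :
      ‖Fintype.linearCombination 𝕜 w c‖ ≤ ‖Fintype.linearCombination 𝕜 v c‖ := by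
    have hc := (RCLike.nonneg_iff.1 (h.dotProduct_mulVec_nonneg c)).1
    rw [sub_mulVec, dotProduct_sub, star_dotProduct_gram_mulVec, star_dotProduct_gram_mulVec,
      map_sub, inner_self_eq_norm_sq, inner_self_eq_norm_sq, sub_nonneg] at hc
    exact (sq_le_sq₀ (norm_nonneg _) (norm_nonneg _)).1 hc
  obtain ⟨T, hT, hTv⟩ := exists_norm_le_one_comp_eq_of_norm_le norm_le
  exact ⟨T, hT, fun p => by simpa using hTv (Pi.single p 1)⟩

theorem posSemidef_one_sub_conjTranspose_mul_self [Fintype m] [Fintype n] [DecidableEq n]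
    {U : Matrix m n 𝕜} (hU : ∀ x, ‖toEuclideanLin U x‖ ≤ ‖x‖) : (1 - Uᴴ * U).PosSemidef := by
  classical
  have isHermitian : (1 - Uᴴ * U).IsHermitian :=
    isHermitian_one.sub (isHermitian_conjTranspose_mul_self U)
  rw [← isPositive_toEuclideanLin_iff]
  refine ⟨isSymmetric_toEuclideanLin_iff.2 isHermitian, fun x => ?_⟩
  have toEuclideanLin_apply_eq : (1 - Uᴴ * U).toEuclideanLin x =
      x - U.toEuclideanLin.adjoint (U.toEuclideanLin x) := by
    rw [← toEuclideanLin_conjTranspose_eq_adjoint]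
    ext i
    simp [mulVec_mulVec]
  rw [toEuclideanLin_apply_eq, inner_sub_left, LinearMap.adjoint_inner_left, map_sub,
    inner_self_eq_norm_sq, inner_self_eq_norm_sq, sub_nonneg]
  exact pow_le_pow_left₀ (norm_nonneg _) (hU x) 2

theorem trace_mul_mul_conjTranspose_le [Fintype m] [Fintype n] [DecidableEq n]
    {U : Matrix m n 𝕜} (hU : (1 - Uᴴ * U).PosSemidef) {σ : Matrix n n 𝕜} (hσ : σ.PosSemidef) :
    (U * σ * Uᴴ).trace ≤ σ.trace := by
  open scoped MatrixOrder in
  obtain ⟨C, rfl⟩ := CStarAlgebra.nonneg_iff_eq_star_mul_self.1 hσ.nonneg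
  have htr := (hU.mul_mul_conjTranspose_same C).trace_nonneg
  rw [star_eq_conjTranspose, ← sub_nonneg]
  convert htr using 1
  rw [Matrix.mul_sub, Matrix.sub_mul, trace_sub, Matrix.mul_one, trace_mul_comm C,
    trace_mul_cycle U, trace_mul_cycle C, trace_mul_comm (Cᴴ * C)]

end Contraction

section Kraus

variable {m n k ι κ : Type*}

theorem IsCompletelyPositive.comp {Φ : Matrix m m ℂ →ₗ[ℂ] Matrix k k ℂ}
    {Ψ : Matrix n n ℂ →ₗ[ℂ] Matrix m m ℂ} (hΦ : IsCompletelyPositive Φ)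
    (hΨ : IsCompletelyPositive Ψ) : IsCompletelyPositive (Φ ∘ₗ Ψ) :=
  fun r M hM => hΦ r _ (hΨ r M hM)

theorem IsCompletelyPositive.posSemidef_apply {Φ : Matrix n n ℂ →ₗ[ℂ] Matrix m m ℂ}
    (hΦ : IsCompletelyPositive Φ) {ρ : Matrix n n ℂ} (hρ : ρ.PosSemidef) : (Φ ρ).PosSemidef :=
  (hΦ 1 _ (hρ.submatrix Prod.snd)).submatrix fun a => (0, a)

theorem IsCompletelyPositive.re_apply_single_mem_Icc [Fintype m] [Fintype n] [DecidableEq n]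
    {Φ : Matrix n n ℂ →ₗ[ℂ] Matrix m m ℂ} (hΦ : IsCompletelyPositive Φ)
    (htr : ∀ ρ : Matrix n n ℂ, ρ.PosSemidef → (Φ ρ).trace ≤ ρ.trace) (i : n) (a : m) :
    (Φ (single i i 1) a a).re ∈ Set.Icc 0 1 := by
  have single_pos : (single i i (1 : ℂ)).PosSemidef := by
    rw [← diagonal_single, posSemidef_diagonal_iff]
    exact Pi.single_nonneg (i := i).2 zero_le_one
  have image_pos := hΦ.posSemidef_apply single_pos
  have le_one : Φ (single i i 1) a a ≤ 1 := calc
    Φ (single i i 1) a a ≤ (Φ (single i i 1)).trace :=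
      Finset.single_le_sum (f := fun b => Φ (single i i 1) b b)
        (fun b _ => image_pos.diag_nonneg) (Finset.mem_univ a)
    _ ≤ (single i i (1 : ℂ)).trace := htr _ single_pos
    _ = 1 := trace_single_eq_same i 1
  exact ⟨(Complex.nonneg_iff.1 image_pos.diag_nonneg).1, (Complex.le_def.1 le_one).1⟩

theorem krausMap_apply [Fintype n] [Fintype ι] (K : ι → Matrix m n ℂ) (ρ : Matrix n n ℂ) :
    krausMap K ρ = ∑ i, K i * ρ * (K i)ᴴ :=
  rfl

theorem isCompletelyPositive_krausMap [Finite m] [Fintype n] [Fintype ι] (K : ι → Matrix m n ℂ) :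
    IsCompletelyPositive (krausMap K) := by
  intro r M hM
  let L (i : ι) : Matrix (Fin r × m) (Fin r × n) ℂ :=
    of fun p q => if p.1 = q.1 then K i p.2 q.2 else 0
  have ampliation_eq : ampliation r (krausMap K) M = ∑ i, L i * M * (L i)ᴴ := by
    ext p q
    simp [ampliation, krausMap_apply, L, Matrix.sum_apply, mul_apply, Fintype.sum_prod_type,
      ite_mul, apply_ite, Finset.sum_ite_irrel]
  rw [ampliation_eq]
  exact posSemidef_sum _ fun i _ => hM.mul_mul_conjTranspose_same (L i)

theorem trace_krausMap [Fintype m] [Fintype n] [Fintype ι] (K : ι → Matrix m n ℂ)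
    (ρ : Matrix n n ℂ) : (krausMap K ρ).trace = ((∑ i, (K i)ᴴ * K i) * ρ).trace := by
  simp only [krausMap_apply, trace_sum, Finset.sum_mul]
  exact Finset.sum_congr rfl fun i _ => trace_mul_cycle _ _ _

theorem isChannel_krausMap [Fintype m] [Fintype n] [DecidableEq n] [Fintype ι]
    {K : ι → Matrix m n ℂ} (hK : ∑ i, (K i)ᴴ * K i = 1) : IsChannel (krausMap K) where
  completelyPositive := isCompletelyPositive_krausMap K
  tracePreserving ρ := by rw [trace_krausMap, hK, one_mul]

theorem choiMatrix_krausMap_apply [Fintype n] [DecidableEq n] [Fintype ι] (K : ι → Matrix m n ℂ)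
    (p q : n × m) :
    choiMatrix (krausMap K) p q = ∑ i, K i p.2 p.1 * star (K i q.2 q.1) := by
  simp [choiMatrix, krausMap_apply, Matrix.sum_apply, mul_apply, single_apply, ite_and]

/-- The entries of a Kraus family as vectors in `ℂ^ι`, one for each position in the Kraus operators.
The input index comes first, as in `choiMatrix`. -/
def krausVector (K : ι → Matrix m n ℂ) (p : n × m) : EuclideanSpace ℂ ι :=
  WithLp.toLp 2 fun i => K i p.2 p.1

theorem gram_krausVector [Fintype n] [DecidableEq n] [Fintype ι] (K : ι → Matrix m n ℂ) :
    gram ℂ (krausVector K) = (choiMatrix (krausMap K))ᵀ := by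
  ext p q
  simp [gram_apply, krausVector, choiMatrix_krausMap_apply, PiLp.inner_apply]

theorem exists_contraction_of_krausMap_eq [Finite m] [Fintype n] [Fintype ι] [DecidableEq ι]
    [Fintype κ] {K : ι → Matrix m n ℂ} {L : κ → Matrix m n ℂ} (h : krausMap K = krausMap L) :
    ∃ U : Matrix κ ι ℂ, (1 - Uᴴ * U).PosSemidef ∧ ∀ e, L e = ∑ i, U e i • K i := by
  classical
  have gram_sub : (gram ℂ (krausVector K) - gram ℂ (krausVector L)).PosSemidef := by
    rw [gram_krausVector, gram_krausVector, h, sub_self]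
    exact .zero
  obtain ⟨T, hT, hTK⟩ := exists_norm_le_one_apply_eq_of_posSemidef_gram_sub_gram gram_sub
  obtain ⟨U, hU⟩ := toEuclideanLin.surjective T.toLinearMap
  refine ⟨U, posSemidef_one_sub_conjTranspose_mul_self fun x => ?_, fun e => ?_⟩
  · rw [hU]
    exact T.le_of_opNorm_le_of_le hT le_rfl |>.trans_eq (one_mul _)
  · ext a j
    have hUK : toEuclideanLin U (krausVector K (j, a)) = krausVector L (j, a) := by
      rw [hU]
      exact hTK (j, a)
    simpa [krausVector, mulVec, dotProduct, Matrix.sum_apply] using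
      (congrArg (fun v => v.ofLp e) hUK).symm

end Kraus

section Complementary

variable {m n k ι : Type*}

/-- The Stinespring operator of a Kraus family: the Kraus operators are its blocks with respect
to the standard basis of the environment `ι`. -/
def stinespring (K : ι → Matrix m n ℂ) : Matrix (m × ι) n ℂ :=
  of fun p j => K p.2 p.1 j

/-- The Kraus operators of the complementary map of `krausMap K`: they are the blocks of
`stinespring K` with respect to the standard basis of the output space. -/
def complementaryKraus (K : ι → Matrix m n ℂ) : m → Matrix ι n ℂ :=
  fun a => of fun e j => K e a j

theorem traceSnd_stinespring [Fintype n] [Fintype ι] (K : ι → Matrix m n ℂ) (ρ : Matrix n n ℂ) :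
    traceSnd (stinespring K * ρ * (stinespring K)ᴴ) = krausMap K ρ := by
  ext a b
  simp [traceSnd, stinespring, krausMap_apply, Matrix.sum_apply, mul_apply]

theorem traceFst_stinespring [Fintype m] [Fintype n] (K : ι → Matrix m n ℂ) (ρ : Matrix n n ℂ) :
    traceFst (stinespring K * ρ * (stinespring K)ᴴ) = krausMap (complementaryKraus K) ρ := by
  ext e f
  simp [traceFst, stinespring, complementaryKraus, krausMap_apply, Matrix.sum_apply, mul_apply]

theorem conjTranspose_stinespring_mul_self [Fintype m] [Fintype ι] (K : ι → Matrix m n ℂ) :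
    (stinespring K)ᴴ * stinespring K = ∑ e, (K e)ᴴ * K e := by
  ext i j
  simp [stinespring, mul_apply, Matrix.sum_apply, Fintype.sum_prod_type_right]

theorem sum_conjTranspose_mul_self_complementaryKraus [Fintype m] [Fintype ι]
    (K : ι → Matrix m n ℂ) :
    ∑ a, (complementaryKraus K a)ᴴ * complementaryKraus K a = ∑ e, (K e)ᴴ * K e := by
  ext i j
  simpa [complementaryKraus, mul_apply, Matrix.sum_apply] using Finset.sum_comm

theorem isComplementary_iff_exists_kraus [Fintype m] [Fintype n] [DecidableEq n] [Fintype k]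
    {Ψ : Matrix n n ℂ →ₗ[ℂ] Matrix m m ℂ} {Ψc : Matrix n n ℂ →ₗ[ℂ] Matrix k k ℂ} :
    IsComplementary Ψ Ψc ↔ ∃ K : k → Matrix m n ℂ, ∑ e, (K e)ᴴ * K e = 1 ∧
      Ψ = krausMap K ∧ Ψc = krausMap (complementaryKraus K) := by
  constructor
  · rintro ⟨-, -, V, hV, hΨ, hΨc⟩
    obtain ⟨K, rfl⟩ : ∃ K, V = stinespring K := ⟨fun e => of fun a j => V (a, e) j, rfl⟩
    rw [conjTranspose_stinespring_mul_self] at hV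
    exact ⟨K, hV, LinearMap.ext fun ρ => (hΨ ρ).trans (traceSnd_stinespring K ρ),
      LinearMap.ext fun ρ => (hΨc ρ).trans (traceFst_stinespring K ρ)⟩
  · rintro ⟨K, hK, rfl, rfl⟩
    exact ⟨isChannel_krausMap hK,
      isChannel_krausMap ((sum_conjTranspose_mul_self_complementaryKraus K).trans hK),
      stinespring K, (conjTranspose_stinespring_mul_self K).trans hK,
      fun ρ => (traceSnd_stinespring K ρ).symm, fun ρ => (traceFst_stinespring K ρ).symm⟩

theorem IsAntidegradable.exists_krausMap_eq_comp [Fintype m] [Fintype n] [DecidableEq n]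
    [Fintype ι] {K : ι → Matrix m n ℂ} (h : IsAntidegradable (krausMap K)) :
    ∃ Ξ : Matrix ι ι ℂ →ₗ[ℂ] Matrix m m ℂ, IsCompletelyPositive Ξ ∧
      (∀ σ : Matrix ι ι ℂ, σ.PosSemidef → (Ξ σ).trace ≤ σ.trace) ∧
      krausMap K = Ξ ∘ₗ krausMap (complementaryKraus K) := by
  classical
  obtain ⟨d, _, Ξ, hcompl, hΞ, hdeg⟩ := h
  obtain ⟨L, -, hKL, rfl⟩ := isComplementary_iff_exists_kraus.1 hcompl
  obtain ⟨U, hU, hLU⟩ := exists_contraction_of_krausMap_eq hKL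
  have complementary_eq (a : m) : complementaryKraus L a = U * complementaryKraus K a := by
    ext e j
    simp [complementaryKraus, hLU, Matrix.sum_apply, mul_apply]
  let conjU := krausMap fun _ : Unit => U
  have conjU_apply (σ : Matrix ι ι ℂ) : conjU σ = U * σ * Uᴴ := by simp [conjU, krausMap_apply]
  refine ⟨Ξ ∘ₗ conjU, hΞ.completelyPositive.comp (isCompletelyPositive_krausMap _),
    fun σ hσ => ?_, ?_⟩
  · rw [LinearMap.comp_apply, hΞ.tracePreserving, conjU_apply]
    exact trace_mul_mul_conjTranspose_le hU hσ
  · rw [hdeg, LinearMap.comp_assoc]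
    congr 1
    ext1 ρ
    simp [conjU_apply, krausMap_apply, complementary_eq, Matrix.mul_sum, Matrix.sum_mul,
      Matrix.mul_assoc]

end Complementary

/-- The Kraus family of `Φ` with arbitrary reals `a, b, s, t` in place of
`cos α, cos β, sin α, sin β`. Complementary and degrading maps of such maps are again of this
shape. -/
def krausPair (a b s t : ℝ) : Fin 2 → Matrix (Fin 2) (Fin 2) ℂ :=
  ![!![(a : ℂ), 0; 0, (b : ℂ)], !![0, (t : ℂ); (s : ℂ), 0]]

section KrausPair

variable {a b s t : ℝ}

theorem krausPair_cos_sin (α β : ℝ) :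
    krausPair (Real.cos α) (Real.cos β) (Real.sin α) (Real.sin β) = ![kraus₁ α β, kraus₂ α β] :=
  rfl

theorem complementaryKraus_krausPair (a b s t : ℝ) :
    complementaryKraus (krausPair a b s t) = krausPair a t s b := by
  ext x e j
  fin_cases x <;> fin_cases e <;> fin_cases j <;> rfl

theorem sum_conjTranspose_mul_self_krausPair (h₀ : a ^ 2 + s ^ 2 = 1) (h₁ : b ^ 2 + t ^ 2 = 1) :
    ∑ e, (krausPair a b s t e)ᴴ * krausPair a b s t e = 1 := by
  have h₀' : (a : ℂ) * a + s * s = 1 := by exact_mod_cast (by linarith : a * a + s * s = 1)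
  have h₁' : (b : ℂ) * b + t * t = 1 := by exact_mod_cast (by linarith : b * b + t * t = 1)
  ext i j
  fin_cases i <;> fin_cases j <;> simp [krausPair, mul_apply, h₀', h₁']

theorem krausMap_krausPair (a b s t : ℝ) (ρ : Matrix (Fin 2) (Fin 2) ℂ) :
    krausMap (krausPair a b s t) ρ =
      !![(a : ℂ) ^ 2 * ρ 0 0 + (t : ℂ) ^ 2 * ρ 1 1, (a : ℂ) * b * ρ 0 1 + (s : ℂ) * t * ρ 1 0;
        (a : ℂ) * b * ρ 1 0 + (s : ℂ) * t * ρ 0 1, (b : ℂ) ^ 2 * ρ 1 1 + (s : ℂ) ^ 2 * ρ 0 0] := by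
  ext i j
  fin_cases i <;> fin_cases j <;>
    simp [krausMap_apply, krausPair, mul_apply, Fin.sum_univ_two, -cons_mul] <;> ring

theorem krausMap_krausPair_single_zero (a b s t : ℝ) :
    krausMap (krausPair a b s t) (single 0 0 1) =
      (a : ℂ) ^ 2 • single 0 0 1 + (s : ℂ) ^ 2 • single 1 1 1 := by
  rw [krausMap_krausPair]
  ext i j
  fin_cases i <;> fin_cases j <;> simp

theorem krausMap_krausPair_single_one (a b s t : ℝ) :
    krausMap (krausPair a b s t) (single 1 1 1) =
      (t : ℂ) ^ 2 • single 0 0 1 + (b : ℂ) ^ 2 • single 1 1 1 := by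
  rw [krausMap_krausPair]
  ext i j
  fin_cases i <;> fin_cases j <;> simp

theorem krausMap_krausPair_eq_comp {x y : ℝ} (hx : 0 ≤ x) (hy : 0 ≤ y)
    (h₀ : x * t ^ 2 + y * s ^ 2 = 1) (h₁ : x * b ^ 2 + y * a ^ 2 = 1) :
    krausMap (krausPair a b s t) =
      krausMap (krausPair (√x * t) (√x * b) (√y * s) (√y * a)) ∘ₗ
        krausMap (krausPair a t s b) := by
  have hx' : ((√x : ℝ) : ℂ) ^ 2 = x := by exact_mod_cast Real.sq_sqrt hx
  have hy' : ((√y : ℝ) : ℂ) ^ 2 = y := by exact_mod_cast Real.sq_sqrt hy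
  have h₀' : (√x : ℂ) ^ 2 * t ^ 2 + (√y : ℂ) ^ 2 * s ^ 2 = 1 := by
    rw [hx', hy']; exact_mod_cast h₀
  have h₁' : (√x : ℂ) ^ 2 * b ^ 2 + (√y : ℂ) ^ 2 * a ^ 2 = 1 := by
    rw [hx', hy']; exact_mod_cast h₁
  ext1 ρ
  simp only [LinearMap.comp_apply, krausMap_krausPair, of_apply, cons_val, Complex.ofReal_mul]
  congrm !![?_, ?_; ?_, ?_]
  · linear_combination -(a : ℂ) ^ 2 * ρ 0 0 * h₀' - (t : ℂ) ^ 2 * ρ 1 1 * h₁'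
  · linear_combination -(a : ℂ) * b * ρ 0 1 * h₀' - (s : ℂ) * t * ρ 1 0 * h₁'
  · linear_combination -(a : ℂ) * b * ρ 1 0 * h₀' - (s : ℂ) * t * ρ 0 1 * h₁'
  · linear_combination -(s : ℂ) ^ 2 * ρ 0 0 * h₁' - (b : ℂ) ^ 2 * ρ 1 1 * h₀'

theorem isAntidegradable_krausMap_krausPair {r : ℝ} (h₀ : a ^ 2 + s ^ 2 = 1)
    (h₁ : b ^ 2 + t ^ 2 = 1) (hr : |r| ≤ 1)
    (h : ((a ^ 2 - s ^ 2) - (b ^ 2 - t ^ 2)) * r = (a ^ 2 - s ^ 2) + (b ^ 2 - t ^ 2)) :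
    IsAntidegradable (krausMap (krausPair a b s t)) := by
  obtain ⟨hr₀, hr₁⟩ := abs_le.1 hr
  have hx : 0 ≤ 1 + r := by linarith
  have hy : 0 ≤ 1 - r := by linarith
  have h₂ : (1 + r) * t ^ 2 + (1 - r) * s ^ 2 = 1 := by
    linear_combination (1 - r) / 2 * h₀ + (1 + r) / 2 * h₁ + h / 2
  have h₃ : (1 + r) * b ^ 2 + (1 - r) * a ^ 2 = 1 := by
    linear_combination (1 - r) / 2 * h₀ + (1 + r) / 2 * h₁ - h / 2
  refine ⟨2, krausMap (krausPair a t s b), _, isComplementary_iff_exists_kraus.2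
      ⟨_, sum_conjTranspose_mul_self_krausPair h₀ h₁, rfl, by rw [complementaryKraus_krausPair]⟩,
    isChannel_krausMap (sum_conjTranspose_mul_self_krausPair ?_ ?_),
    krausMap_krausPair_eq_comp hx hy h₂ h₃⟩
  · rw [mul_pow, mul_pow, Real.sq_sqrt hx, Real.sq_sqrt hy, h₂]
  · rw [mul_pow, mul_pow, Real.sq_sqrt hx, Real.sq_sqrt hy, h₃]

theorem IsAntidegradable.exists_abs_le_one_krausPair (h₀ : a ^ 2 + s ^ 2 = 1)
    (h₁ : b ^ 2 + t ^ 2 = 1) (h : IsAntidegradable (krausMap (krausPair a b s t))) :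
    ∃ r : ℝ, |r| ≤ 1 ∧
      ((a ^ 2 - s ^ 2) - (b ^ 2 - t ^ 2)) * r = (a ^ 2 - s ^ 2) + (b ^ 2 - t ^ 2) := by
  obtain ⟨Ξ, hpos, htr, hcomp⟩ := h.exists_krausMap_eq_comp
  rw [complementaryKraus_krausPair] at hcomp
  obtain ⟨hp₀, hp₁⟩ := hpos.re_apply_single_mem_Icc htr 0 0
  obtain ⟨hq₀, hq₁⟩ := hpos.re_apply_single_mem_Icc htr 1 0
  set p := (Ξ (single 0 0 1) 0 0).re
  set q := (Ξ (single 1 1 1) 0 0).re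
  have re_combination (c d : ℝ) :
      (Ξ ((c : ℂ) ^ 2 • single 0 0 1 + (d : ℂ) ^ 2 • single 1 1 1) 0 0).re =
        c ^ 2 * p + d ^ 2 * q := by
    rw [map_add, map_smul, map_smul, ← Complex.ofReal_pow, ← Complex.ofReal_pow, Matrix.add_apply,
      Matrix.smul_apply, Matrix.smul_apply, Complex.add_re, smul_eq_mul, smul_eq_mul,
      Complex.re_ofReal_mul, Complex.re_ofReal_mul]
  have re_eq (ρ : Matrix (Fin 2) (Fin 2) ℂ) : (krausMap (krausPair a b s t) ρ 0 0).re =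
      (Ξ (krausMap (krausPair a t s b) ρ) 0 0).re := by
    rw [hcomp, LinearMap.comp_apply]
  have a_sq_eq : a ^ 2 = a ^ 2 * p + s ^ 2 * q := by
    rw [← re_combination, ← krausMap_krausPair_single_zero a t s b, ← re_eq,
      krausMap_krausPair_single_zero]
    simp [← Complex.ofReal_pow]
  have t_sq_eq : t ^ 2 = b ^ 2 * p + t ^ 2 * q := by
    rw [← re_combination, ← krausMap_krausPair_single_one a t s b, ← re_eq,
      krausMap_krausPair_single_one]
    simp [← Complex.ofReal_pow]
  exact ⟨p - q, abs_le.2 ⟨by linarith, by linarith⟩, by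
    linear_combination (1 - p - q) * (h₀ - h₁) - 2 * (a_sq_eq - t_sq_eq)⟩

end KrausPair

end QChannel

theorem mainTheorem2_general (α β : ℝ) :
    QChannel.IsAntidegradable (QChannel.krausMap ![QChannel.kraus₁ α β, QChannel.kraus₂ α β]) ↔
      Real.cos (2 * α) * Real.cos (2 * β) ≤ 0 := by
  rw [← QChannel.krausPair_cos_sin, QChannel.mul_nonpos_iff_exists_abs_le_one,
    Real.cos_two_mul', Real.cos_two_mul']
  have hα := Real.cos_sq_add_sin_sq α
  have hβ := Real.cos_sq_add_sin_sq β
  exact ⟨QChannel.IsAntidegradable.exists_abs_le_one_krausPair hα hβ, fun ⟨_, hr, h⟩ =>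
    QChannel.isAntidegradable_krausMap_krausPair hα hβ hr h⟩

theorem mainTheorem2 (α β : ℝ)
    (Φ : Matrix (Fin 2) (Fin 2) ℂ →ₗ[ℂ] Matrix (Fin 2) (Fin 2) ℂ)
    (hΦ : Φ = QChannel.krausMap ![QChannel.kraus₁ α β, QChannel.kraus₂ α β])
    (hrank : (QChannel.choiMatrix Φ).rank = 2) :
    QChannel.IsAntidegradable Φ ↔ Real.cos (2 * α) * Real.cos (2 * β) ≤ 0 := by
  rw [hΦ]
  exact mainTheorem2_general α β
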